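/- All topological spaces, and all (real) topological vector spaces, are assumed Hausdorff. For a subset $Y$ of a real vector space put $\operatorname{conv}_2(Y):=\{t_1y_1+t_2y_2 : y_1,y_2\in Y,\ t_1,t_2\ge 0,\ t_1+t_2=1\}$. **Setting.** Let $M$ be a topological space, $(A,\le)$ a directed set and $(M_\alpha)_{\alpha\in A}$ a family of topological spaces whose underlying sets are subsets of $M$, with $M_\alpha\subseteq M_\beta$ for $\alpha\le\beta$, such that all inclusion maps $M_\alpha\to M$ and $M_\alpha\to M_\beta$ ($\alpha\le\beta$) are continuous (they need not be embeddings). Assume that $M=\bigcup_{\alpha\in A}M_\alpha$. **Well-filled charts.** A homeomorphism $\phi\colon U\to V\subseteq E$ from an open subset $U\subseteq M$ onto an arbitrary subset $V$ of a topological vector space $E$ is called a *well-filled chart* of $M$ if there exist $\alpha_0\in A$, homeomorphisms $\phi_\alpha\colon U_\alpha\to V_\alpha\subseteq E_\alpha$ from open subsets $U_\alpha\subseteq M_\alpha$ onto subsets $V_\alpha$ of topological vector spaces $E_\alpha$ (for $\alpha\ge\alpha_0$), and continuous linear maps $\lambda_\alpha\colon E_\alpha\to E$ and $\lambda_{\beta,\alpha}\colon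 E_\alpha\to E_\beta$ (for $\beta\ge\alpha\ge\alpha_0$) such that: - (a) for all $\alpha\ge\alpha_0$: $U_\alpha\subseteq U$ and $\phi|_{U_\alpha}=\lambda_\alpha\circ\phi_\alpha$; - (b) for all $\beta\ge\alpha\ge\alpha_0$: $U_\alpha\subseteq U_\beta$ and $\phi_\beta|_{U_\alpha}=\lambda_{\beta,\alpha}\circ\phi_\alpha$; - (d) $\bigcup_{\alpha\ge\alpha_0}U_\alpha=U\cap\bigcup_{\alpha\in A}M_\alpha$; - (e) there is a non-empty relatively open subset $V^{(2)}\subseteq V$ such that $\operatorname{conv}_2(V^{(2)})\subseteq V$ and $\operatorname{conv}_2(V^{(2)}\cap V_\infty)\subseteq V_\infty$, where $V_\infty:=\bigcup_{\alpha\ge\alpha_0}\lambda_\alpha(V_\alpha)$; - (f) for this $V^{(2)}$, for each $\alpha\ge\alpha_0$ and each compact set $K\subseteq V_\alpha$ with $\lambda_\alpha(K)\subseteq V^{(2)}$, there is $\beta\ge\alpha$ such that $\operatorname{conv}_2(\lambda_{\beta,\alpha}(K))\subseteq V_\beta$. (In the usual case where $E_\alpha\subseteq E_\beta\subseteq E$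 and all $\lambda_\alpha$, $\lambda_{\beta,\alpha}$ are inclusion maps, (f) says that for each compact $K\subseteq V^{(2)}\cap V_\alpha$ there is $\beta\ge\alpha$ with $\operatorname{conv}_2(K)\subseteq V_\beta$.) Then $\phi^{-1}(V^{(2)})$ is called a *core* of $\phi$. The space $M$ *admits well-filled charts* if the cores of well-filled charts cover $M$. **Corollary.** If, in this setting, $M$ admits well-filled charts, then $$M_{(p)}=\bigcup_{\alpha\in A_p}(M_\alpha)_{(p)}\qquad\text{for all }p\in M,$$ where $A_p:=\{\alpha\in A : p\in M_\alpha\}$, and $X_{(p)}$ denotes the path component of $p$ in a topological space $X$ (for $X=M_\alpha$, with respect to the topology of $M_\alpha$). -/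

import Mathlib

universe uA uM uE uF

/-- A family `(M_α)` of topological spaces, indexed by the preordered set `A`, whose underlying sets
are subsets of the topological space `M` and increase with `α`. Each `M_α` carries its own topology
(not necessarily the subspace topology), such that all inclusion maps `M_α → M` and `M_α → M_β`
(for `α ≤ β`) are continuous. -/
structure DirectedFamily (A : Type uA) [Preorder A] (M : Type uM) [TopologicalSpace M] where
  carrier : A → Set M
  mono : ∀ ⦃α β : A⦄, α ≤ β → carrier α ⊆ carrier β
  top : ∀ α, TopologicalSpace (carrier α)
  continuous_val : ∀ α, @Continuous (carrier α) M (top α) _ Subtype.val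
  continuous_inclusion : ∀ ⦃α β : A⦄ (h : α ≤ β),
    @Continuous (carrier α) (carrier β) (top α) (top β) (Set.inclusion (mono h))

namespace DirectedFamily

variable {A : Type uA} [Preorder A] {M : Type uM} [TopologicalSpace M] (F : DirectedFamily A M)

/-- The space `M_α` as a type, with its own topology (a separate type name, so that the subspace
topology of `M` is never picked up by accident). -/
def Step (α : A) : Type uM := {x : M // x ∈ F.carrier α}

instance (α : A) : TopologicalSpace (F.Step α) := F.top α

/-- The inclusion map `M_α → M`. -/
def toSpace (α : A) (x : F.Step α) : M := x.1

/-- The inclusion map `M_α → M_β` for `α ≤ β`. -/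
def toStep {α β : A} (h : α ≤ β) (x : F.Step α) : F.Step β := ⟨x.1, F.mono h x.2⟩

/-- A point of `M` lying in the set `M_α`, as a point of the space `M_α`. -/
def mkStep {α : A} (p : M) (hp : p ∈ F.carrier α) : F.Step α := ⟨p, hp⟩

/-- The union `M_∞` of all `M_α`. -/
def union : Set M := ⋃ α, F.carrier α

end DirectedFamily

/-- `conv₂(Y)`: all convex combinations `t₁ y₁ + t₂ y₂` of two elements of `Y`. -/
def convTwo {E : Type*} [AddCommGroup E] [Module ℝ E] (Y : Set E) : Set E :=
  {z | ∃ y₁ ∈ Y, ∃ y₂ ∈ Y, ∃ t₁ t₂ : ℝ,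
    0 ≤ t₁ ∧ 0 ≤ t₂ ∧ t₁ + t₂ = 1 ∧ z = t₁ • y₁ + t₂ • y₂}

/-- A homeomorphism `φ : U → V ⊆ E` from an open subset `U` of `M` onto a subset `V` of a (real,
Hausdorff) topological vector space `E`, together with an index `α₀` and, for `α ≥ α₀`,
homeomorphisms `φ_α : U_α → V_α ⊆ E_α` from open subsets `U_α` of `M_α` onto subsets of topological
vector spaces `E_α`, and continuous linear maps `λ_α : E_α → E` and `λ_{β,α} : E_α → E_β`, subject
to the compatibility conditions (a), (b), (d). -/
structure FilledChart {A : Type uA} [Preorder A] {M : Type uM} [TopologicalSpace M]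
    (F : DirectedFamily A M) where
  /-- the modelling space `E` -/
  E : Type uE
  [addCommGroupE : AddCommGroup E]
  [moduleE : Module ℝ E]
  [topE : TopologicalSpace E]
  [topAddGroupE : IsTopologicalAddGroup E]
  [contSMulE : ContinuousSMul ℝ E]
  [t2E : T2Space E]
  /-- the domain of `φ` -/
  U : Set M
  isOpen_U : IsOpen U
  /-- the image of `φ`, an arbitrary subset of `E` -/
  V : Set E
  φ : U ≃ₜ V
  /-- the index `α₀` -/
  base : A
  /-- the modelling spaces `E_α` -/
  Es : Set.Ici base → Type uF
  [addCommGroupEs : ∀ α, AddCommGroup (Es α)]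
  [moduleEs : ∀ α, Module ℝ (Es α)]
  [topEs : ∀ α, TopologicalSpace (Es α)]
  [topAddGroupEs : ∀ α, IsTopologicalAddGroup (Es α)]
  [contSMulEs : ∀ α, ContinuousSMul ℝ (Es α)]
  [t2Es : ∀ α, T2Space (Es α)]
  /-- the open sets `U_α ⊆ M_α` -/
  Us : ∀ α : Set.Ici base, Set (F.Step α)
  isOpen_Us : ∀ α : Set.Ici base, IsOpen (Us α)
  Vs : ∀ α : Set.Ici base, Set (Es α)
  φs : ∀ α : Set.Ici base, Us α ≃ₜ Vs α
  /-- the maps `λ_α : E_α → E` -/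
  lam : ∀ α : Set.Ici base, Es α →L[ℝ] E
  /-- the maps `λ_{β,α} : E_α → E_β` -/
  lams : ∀ α β : Set.Ici base, α ≤ β → (Es α →L[ℝ] Es β)
  /-- (a), first part: `U_α ⊆ U` -/
  Us_subset : ∀ α : Set.Ici base, ∀ x ∈ Us α, F.toSpace α x ∈ U
  /-- (a), second part: `φ|_{U_α} = λ_α ∘ φ_α` -/
  φ_eq : ∀ (α : Set.Ici base) (x : Us α), (φ ⟨F.toSpace α x, Us_subset α x x.2⟩ : E) = lam α (φs α x)
  /-- (b), first part: `U_α ⊆ U_β` -/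
  Us_mono : ∀ (α β : Set.Ici base) (h : α ≤ β), ∀ x ∈ Us α, F.toStep h x ∈ Us β
  /-- (b), second part: `φ_β|_{U_α} = λ_{β,α} ∘ φ_α` -/
  φs_eq : ∀ (α β : Set.Ici base) (h : α ≤ β) (x : Us α),
    (φs β ⟨F.toStep h x, Us_mono α β h x x.2⟩ : Es β) = lams α β h (φs α x)
  /-- (d): the union of the `U_α` is `U ∩ M_∞` -/
  iUnion_Us : (⋃ α : Set.Ici base, F.toSpace α '' Us α) = U ∩ F.union

attribute [instance] FilledChart.addCommGroupE FilledChart.moduleE FilledChart.topE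
  FilledChart.topAddGroupE FilledChart.contSMulE FilledChart.t2E
  FilledChart.addCommGroupEs FilledChart.moduleEs FilledChart.topEs
  FilledChart.topAddGroupEs FilledChart.contSMulEs FilledChart.t2Es

namespace FilledChart

variable {A : Type uA} [Preorder A] {M : Type uM} [TopologicalSpace M] {F : DirectedFamily A M}
  (c : FilledChart.{uA, uM, uE, uF} F)

/-- `V_∞ ⊆ V ⊆ E`, the union of the sets `V_α`, seen in `E` by means of the maps `λ_α`. -/
def Vinf : Set c.E := ⋃ α : Set.Ici c.base, c.lam α '' c.Vs α

/-- The set `V2 = V⁽²⁾` satisfies conditions (e) and (f). If all `E_α` are vector subspaces of `E`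
and all `λ_α`, `λ_{β,α}` are the inclusion maps, condition (f) says: for all `α ≥ α₀` and compact
`K ⊆ V⁽²⁾ ∩ V_α`, there is `β ≥ α` such that `conv₂(K) ⊆ V_β`. Compactness of `K` refers to the
topology of `E_α`, of which `V_α` is a subspace. -/
structure IsCoreImage (V2 : Set c.E) : Prop where
  nonempty : V2.Nonempty
  /-- `V2` is a relatively open subset of `V` -/
  relOpen : ∃ O : Set c.E, IsOpen O ∧ V2 = c.V ∩ O
  conv_subset : convTwo V2 ⊆ c.V
  conv_inf_subset : convTwo (V2 ∩ c.Vinf) ⊆ c.Vinf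
  conv_compact : ∀ α : Set.Ici c.base, ∀ K : Set (c.Es α), IsCompact K → K ⊆ c.Vs α → c.lam α '' K ⊆ V2 →
    ∃ β : Set.Ici c.base, ∃ h : α ≤ β, convTwo (c.lams α β h '' K) ⊆ c.Vs β

/-- `φ⁻¹(V2)`, a subset of `M`. -/
def preimage (V2 : Set c.E) : Set M := {x | ∃ hx : x ∈ c.U, (c.φ ⟨x, hx⟩ : c.E) ∈ V2}

/-- `c` is a well-filled chart: there is a set `V⁽²⁾` as in (e) and (f). -/
def IsWellFilled : Prop := ∃ V2 : Set c.E, c.IsCoreImage V2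

/-- `C` is a core of the chart `c`, i.e. `C = φ⁻¹(V⁽²⁾)` with `V⁽²⁾` as in (e) and (f). -/
def IsCore (C : Set M) : Prop := ∃ V2 : Set c.E, c.IsCoreImage V2 ∧ C = c.preimage V2

end FilledChart

/-- `M` admits well-filled charts: it is covered by the cores of well-filled charts. -/
def DirectedFamily.AdmitsWellFilledCharts {A : Type uA} [Preorder A] {M : Type uM}
    [TopologicalSpace M] (F : DirectedFamily A M) : Prop :=
  ∀ x : M, ∃ c : FilledChart.{uA, uM, uE, uF} F, c.IsWellFilled ∧ ∃ C : Set M, c.IsCore C ∧ x ∈ C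

namespace DirectedFamily

variable {A : Type uA} [Preorder A] {M : Type uM} [TopologicalSpace M] (F : DirectedFamily A M)

/-! Being joined by a path in some `M_α` is symmetric and, as `A` is directed, transitive. Within a
core any two points are so related (`stepJoined_of_mem_preimage`): both lie in a common `U_α`, and
condition (f) for the pair of their images gives `β ≥ α` whose `V_β` contains the segment between
these images in `E_β`; `φ_β⁻¹` turns it into a path in `M_β`. Cores are open and cover `M`, so along
a path in `M` the relation holds locally, hence between its end points, as `[0,1]` is connected.
Conversely, inclusions are continuous and preserve paths. -/

theorem continuous_toSpace (α : A) : Continuous (F.toSpace α) := F.continuous_val α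

theorem continuous_toStep {α β : A} (h : α ≤ β) : Continuous (F.toStep h) :=
  F.continuous_inclusion h

/-- Two points of `M` are joined by a path in some `M_α`. -/
def StepJoined (x y : M) : Prop :=
  ∃ (α : A) (x' y' : F.Step α), F.toSpace α x' = x ∧ F.toSpace α y' = y ∧ Joined x' y'

variable {F}

theorem StepJoined.symm {x y : M} (h : F.StepJoined x y) : F.StepJoined y x := by
  obtain ⟨α, x', y', hx, hy, hj⟩ := h
  exact ⟨α, y', x', hy, hx, hj.symm⟩

/-- Both paths are pushed into one `M_γ` above the two steps and concatenated there. -/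
theorem StepJoined.trans [IsDirectedOrder A] {x y z : M} (h₁ : F.StepJoined x y)
    (h₂ : F.StepJoined y z) : F.StepJoined x z := by
  obtain ⟨α, x', y', rfl, hy, hj⟩ := h₁
  obtain ⟨β, y'', z', hy', rfl, hj'⟩ := h₂
  obtain ⟨γ, hα, hβ⟩ := exists_ge_ge α β
  -- The two copies of the middle point agree in `M_γ` because they agree in `M`.
  have e : F.toStep hα y' = F.toStep hβ y'' := Subtype.ext (hy.trans hy'.symm)
  refine ⟨γ, F.toStep hα x', F.toStep hβ z', rfl, rfl,
    (hj.map (F.continuous_toStep hα)).trans ?_⟩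
  rw [e]
  exact hj'.map (F.continuous_toStep hβ)

end DirectedFamily

namespace FilledChart

variable {A : Type uA} [Preorder A] {M : Type uM} [TopologicalSpace M] {F : DirectedFamily A M}
  (c : FilledChart.{uA, uM, uE, uF} F)

theorem isOpen_preimage {V2 : Set c.E} (hV : c.IsCoreImage V2) : IsOpen (c.preimage V2) := by
  obtain ⟨O, hO, rfl⟩ := hV.relOpen
  have h : IsOpen {u : c.U | (c.φ u : c.E) ∈ O} :=
    hO.preimage (continuous_subtype_val.comp c.φ.continuous)
  convert c.isOpen_U.isOpenMap_subtype_val _ h using 1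
  ext x
  constructor
  · rintro ⟨hx, -, hx'⟩
    exact ⟨⟨x, hx⟩, hx', rfl⟩
  · rintro ⟨u, hu, rfl⟩
    exact ⟨u.2, (c.φ u).2, hu⟩

/-- If the segment between the images of two points of `U_β` lies in `V_β`, the points are joined
by a path in `M_β`. -/
theorem joined_of_convTwo_subset (β : Set.Ici c.base) (x y : c.Us β)
    (h : convTwo {(c.φs β x : c.Es β), (c.φs β y : c.Es β)} ⊆ c.Vs β) :
    Joined (x : F.Step β) (y : F.Step β) := by
  have hmem : ∀ t : unitInterval,
      (1 - t : ℝ) • (c.φs β x : c.Es β) + (t : ℝ) • (c.φs β y : c.Es β) ∈ c.Vs β := fun t ↦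
    h ⟨_, Or.inl rfl, _, Or.inr rfl, 1 - t, t, sub_nonneg.2 t.2.2, t.2.1, by ring, rfl⟩
  have hcont : Continuous fun t : unitInterval ↦
      (1 - t : ℝ) • (c.φs β x : c.Es β) + (t : ℝ) • (c.φs β y : c.Es β) := by fun_prop
  have hV : Joined (c.φs β x) (c.φs β y) :=
    ⟨{ toFun := fun t ↦ ⟨_, hmem t⟩
       continuous_toFun := hcont.subtype_mk hmem
       source' := Subtype.ext (by simp)
       target' := Subtype.ext (by simp) }⟩
  -- The segment is a path for the topology of `E_β`, so `φ_β⁻¹` makes it a path for the topology of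
  -- `M_β`, not merely that of `M`.
  simpa using hV.map (continuous_subtype_val.comp (c.φs β).symm.continuous)

theorem exists_mem_Us {x : M} (hx : x ∈ c.U) (hx' : x ∈ F.union) :
    ∃ α : Set.Ici c.base, ∃ u ∈ c.Us α, F.toSpace α u = x := by
  have h : x ∈ ⋃ α : Set.Ici c.base, F.toSpace α '' c.Us α := c.iUnion_Us ▸ ⟨hx, hx'⟩
  simpa only [Set.mem_iUnion, Set.mem_image] using h

/-- Any two points of `M_∞` in a core are joined by a path in some `M_α`. -/
theorem stepJoined_of_mem_preimage [IsDirectedOrder A] {V2 : Set c.E} (hV : c.IsCoreImage V2)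
    {x y : M} (hx : x ∈ c.preimage V2) (hy : y ∈ c.preimage V2) (hx' : x ∈ F.union)
    (hy' : y ∈ F.union) : F.StepJoined x y := by
  obtain ⟨hxU, hxV⟩ := hx
  obtain ⟨hyU, hyV⟩ := hy
  obtain ⟨α₁, u₁, hu₁, rfl⟩ := c.exists_mem_Us hxU hx'
  obtain ⟨α₂, u₂, hu₂, rfl⟩ := c.exists_mem_Us hyU hy'
  obtain ⟨a, h₁, h₂⟩ := exists_ge_ge (α₁ : A) α₂
  let α : Set.Ici c.base := ⟨a, le_trans α₁.2 h₁⟩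
  let u : c.Us α := ⟨_, c.Us_mono α₁ α h₁ u₁ hu₁⟩
  let v : c.Us α := ⟨_, c.Us_mono α₂ α h₂ u₂ hu₂⟩
  -- A two-point set is compact, and `convTwo` of it is the whole segment.
  obtain ⟨β, hβ, hconv⟩ := hV.conv_compact α {(c.φs α u : c.Es α), (c.φs α v : c.Es α)}
    (Set.toFinite _).isCompact
    (Set.insert_subset (c.φs α u).2 (Set.singleton_subset_iff.2 (c.φs α v).2)) (by
      rintro _ ⟨z, rfl | rfl, rfl⟩
      · rw [← c.φ_eq]; exact hxV
      · rw [← c.φ_eq]; exact hyV)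
  -- By (b), the images of the pair under `λ_{β,α}` are the `φ_β`-values of the same two points.
  rw [Set.image_pair, ← c.φs_eq, ← c.φs_eq] at hconv
  exact ⟨β, _, _, rfl, rfl, c.joined_of_convTwo_subset β _ _ hconv⟩

end FilledChart

/-- A path in a space covered by cores of well-filled charts has end points joined in some
`M_α`. -/
theorem DirectedFamily.AdmitsWellFilledCharts.stepJoined {A : Type uA} [Preorder A]
    [IsDirectedOrder A] {M : Type uM} [TopologicalSpace M] {F : DirectedFamily A M}
    (hF : DirectedFamily.AdmitsWellFilledCharts.{uA, uM, uE, uF} F)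
    (hM : F.union = Set.univ) {x y : M} (h : Joined x y) : F.StepJoined x y := by
  obtain ⟨γ⟩ := h
  have key : F.StepJoined (γ 0) (γ 1) := by
    -- On a preconnected set, a symmetric and transitive relation that links each point to all
    -- nearby points links any two points.
    refine (isPreconnected_univ (α := unitInterval)).induction₂
      (fun s t ↦ F.StepJoined (γ s) (γ t)) (fun s _ ↦ ?_) (fun _ _ _ _ _ _ ↦ .trans)
      (fun _ _ _ _ ↦ .symm) (Set.mem_univ 0) (Set.mem_univ 1)
    obtain ⟨c, -, C, ⟨V2, hV, rfl⟩, hs⟩ := hF (γ s)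
    filter_upwards [nhdsWithin_le_nhds
      (((c.isOpen_preimage hV).preimage γ.continuous).mem_nhds hs)] with t ht
    exact c.stepJoined_of_mem_preimage hV hs ht (hM ▸ Set.mem_univ _) (hM ▸ Set.mem_univ _)
  simpa using key

theorem mainTheorem9 {A : Type uA} [Preorder A] [IsDirectedOrder A]
    {M : Type uM} [TopologicalSpace M] [T2Space M] (F : DirectedFamily A M)
    (hM : (⋃ α, F.carrier α) = Set.univ)
    (hF : DirectedFamily.AdmitsWellFilledCharts.{uA, uM, uE, uF} F) (p : M) :
    pathComponent p =
      ⋃ (α : A) (hp : p ∈ F.carrier α), F.toSpace α '' pathComponent (F.mkStep p hp) := by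
  ext q
  simp only [Set.mem_iUnion]
  constructor
  · intro h
    -- The index `α` delivered here contains `p`, since `p'` is `p` viewed in `M_α`.
    obtain ⟨α, p', q', rfl, rfl, hj⟩ := hF.stepJoined hM h
    exact ⟨α, p'.2, q', hj, rfl⟩
  · rintro ⟨α, hp, q', hj, rfl⟩
    exact Joined.map hj (F.continuous_toSpace α)
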